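/- **Theorem (Tsirelson's Theorem, bis).** Let $X,Y$ be finite non-empty sets of measurement settings and $A,B$ finite sets of outcomes of two parties, Alice and Bob, and let $P(a,b|x,y)$ be a bipartite behavior, i.e. for every $(x,y)\in X\times Y$ a probability distribution on $A\times B$. Suppose that $P$ admits a field (commuting-operator) representation on a separable complex Hilbert space $\mathcal H$, possibly infinite-dimensional: there are a state $\rho$ (a positive trace-class operator on $\mathcal H$ with $\operatorname{tr}\rho=1$) and orthogonal projectors $E^x_a, F^y_b\in B(\mathcal H)$ with $\sum_a E^x_a=\sum_b F^y_b=\mathbb 1$, $[E^x_a,F^y_b]=0$ and $\operatorname{tr}(\rho E^x_aF^y_b)=P(a,b|x,y)$ for all $a,b,x,y$. Put $$\Omega_{\rm A}(M)=\frac1{|X|}\sum_{x\in X}\sum_{a\in A} E^x_aME^x_a,\qquad \Omega_{\rm B}(M)=\frac1{|Y|}\sum_{y\in Y}\sum_{b\in B} F^y_bMF^y_b .$$ Suppose that for $\Omega=\Omega_{\rm A}$ or for $\Omega=\Omega_{\rm B}$ the repeated random measurements produce no Heat Vision, i.e. the sequence $(\Omega^N(\rho))_{N}$ converges in trace norm to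 some trace-class operator as $N\to\infty$. Then $P$ is non-relativistic: there are separable complex Hilbert spaces $\mathcal H_A,\mathcal H_B$, a state $\rho_{AB}$ on the Hilbert space tensor product $\mathcal H_A\otimes\mathcal H_B$, and orthogonal projectors $\tilde E^x_a\in B(\mathcal H_A)$, $\tilde F^y_b\in B(\mathcal H_B)$ with $\sum_a\tilde E^x_a=\mathbb 1$ and $\sum_b\tilde F^y_b=\mathbb 1$ for all $x,y$, such that $\operatorname{tr}\big(\rho_{AB}\,(\tilde E^x_a\otimes\tilde F^y_b)\big)=P(a,b|x,y)$ for all $a,b,x,y$. -/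

import Mathlib

open scoped InnerProductSpace TensorProduct

universe u

noncomputable section

namespace Tsirelson

/-! ### Trace, trace norm and quantum states on a complex Hilbert space -/

section Trace

variable (H : Type u) [NormedAddCommGroup H] [InnerProductSpace ℂ H] [CompleteSpace H]

/-- The index set of a fixed orthonormal (Hilbert) basis of `H`. -/
def basisIndex : Set H := (exists_hilbertBasis ℂ H).choose

/-- A fixed orthonormal (Hilbert) basis of `H`. The notions below that are computed in it
(the trace norm, and the trace of a trace-class operator) do not depend on this choice. -/
def basis : HilbertBasis (basisIndex H) ℂ H := (exists_hilbertBasis ℂ H).choose_spec.choose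

variable {H}

/-- The trace norm `‖T‖₁ = tr |T|` with `|T| = (T† T)^{1/2}`, with values in `[0, ∞]`. -/
def traceNorm (T : H →L[ℂ] H) : ENNReal :=
  ∑' i, ENNReal.ofReal (RCLike.re ⟪basis H i, CFC.abs T (basis H i)⟫_ℂ)

/-- `T` belongs to the trace class `S₁(H)`. -/
def IsTraceClass (T : H →L[ℂ] H) : Prop := traceNorm T < ⊤

/-- The trace; meaningful on trace-class operators. -/
def trace (T : H →L[ℂ] H) : ℂ := ∑' i, ⟪basis H i, T (basis H i)⟫_ℂ

/-- Quantum states (density operators): positive trace-class operators of trace one. -/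
structure IsState (ρ : H →L[ℂ] H) : Prop where
  positive : ρ.IsPositive
  traceClass : IsTraceClass ρ
  trace_eq_one : trace ρ = 1

/-- A family `(M x a)` of projectors that sums up to the identity over the outcomes `a`,
for every measurement setting `x`. -/
structure IsProjectiveMeasurement {X A : Type*} [Fintype A] (M : X → A → H →L[ℂ] H) : Prop where
  projection : ∀ x a, IsStarProjection (M x a)
  sum_eq_one : ∀ x, ∑ a, M x a = 1

/-! ### Repeated random measurements and Heat Vision -/

/-- `Ω_x(T) = ∑ₐ M x a * T * M x a`. -/
def measurementMap {X A : Type*} [Fintype A] (M : X → A → H →L[ℂ] H) (x : X)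
    (T : H →L[ℂ] H) : H →L[ℂ] H :=
  ∑ a, M x a * T * M x a

/-- `Ω(T) = (1 / |X|) ∑ₓ Ω_x(T)`: a measurement setting `x` is chosen uniformly at random, the
measurement is carried out and its outcome is discarded. -/
def randomMeasurement {X A : Type*} [Fintype X] [Fintype A] (M : X → A → H →L[ℂ] H)
    (T : H →L[ℂ] H) : H →L[ℂ] H :=
  (Fintype.card X : ℂ)⁻¹ • ∑ x, measurementMap M x T

/-- Repeated independent random measurements on the state `ρ` produce Heat Vision: the sequence
`Ω^N(ρ)` does not converge in trace norm to any element of the trace class. -/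
def HeatVision {X A : Type*} [Fintype X] [Fintype A] (M : X → A → H →L[ℂ] H)
    (ρ : H →L[ℂ] H) : Prop :=
  ¬ ∃ σ : H →L[ℂ] H, IsTraceClass σ ∧
    Filter.Tendsto (fun N : ℕ => traceNorm ((randomMeasurement M)^[N] ρ - σ))
      Filter.atTop (nhds 0)

end Trace

/-! ### Tensor products of Hilbert spaces -/

section Tensor

variable (HA HB : Type u) [NormedAddCommGroup HA] [InnerProductSpace ℂ HA]
  [NormedAddCommGroup HB] [InnerProductSpace ℂ HB]

/-- The Hilbert space tensor product: the completion of the algebraic tensor product with respect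
to the inner product determined by `⟪a ⊗ b, c ⊗ d⟫ = ⟪a, c⟫ * ⟪b, d⟫`. -/
abbrev HilbertTensor : Type u := UniformSpace.Completion (HA ⊗[ℂ] HB)

variable {HA HB}

/-- The bounded operator `E ⊗ F` on the Hilbert space tensor product. -/
def tensorOp (E : HA →L[ℂ] HA) (F : HB →L[ℂ] HB) :
    HilbertTensor HA HB →L[ℂ] HilbertTensor HA HB :=
  (TensorProduct.mapL E F).completion

end Tensor

/-! ### Bipartite behaviors and their representations -/

/-- A bipartite behavior `P(a,b|x,y)`: a probability distribution of the pair `(a, b)` of outcomes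
for every pair `(x, y)` of settings. -/
structure Behavior (X Y A B : Type*) [Fintype A] [Fintype B] where
  prob : A → B → X → Y → ℝ
  nonneg : ∀ a b x y, 0 ≤ prob a b x y
  sum_eq_one : ∀ x y, ∑ a, ∑ b, prob a b x y = 1

variable {X Y A B : Type*} [Fintype A] [Fintype B]

/-- `(E, F, ρ)` is a field (commuting-operator) representation of the behavior `P` on `H`. -/
structure IsFieldRepresentation (P : Behavior X Y A B)
    {H : Type u} [NormedAddCommGroup H] [InnerProductSpace ℂ H] [CompleteSpace H]
    (E : X → A → H →L[ℂ] H) (F : Y → B → H →L[ℂ] H) (ρ : H →L[ℂ] H) : Prop where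
  state : IsState ρ
  alice : IsProjectiveMeasurement E
  bob : IsProjectiveMeasurement F
  commute : ∀ a b x y, Commute (E x a) (F y b)
  prob_eq : ∀ a b x y, trace (ρ * (E x a * F y b)) = (P.prob a b x y : ℂ)

/-- `P` is non-relativistic: it admits a tensor representation on a pair of (separable)
Hilbert spaces. -/
def IsNonRelativistic (P : Behavior X Y A B) : Prop :=
  ∃ (HA HB : Type u)
    (_ : NormedAddCommGroup HA) (_ : InnerProductSpace ℂ HA) (_ : CompleteSpace HA)
    (_ : NormedAddCommGroup HB) (_ : InnerProductSpace ℂ HB) (_ : CompleteSpace HB)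
    (_ : TopologicalSpace.SeparableSpace HA) (_ : TopologicalSpace.SeparableSpace HB)
    (E : X → A → HA →L[ℂ] HA) (F : Y → B → HB →L[ℂ] HB)
    (ρ : HilbertTensor HA HB →L[ℂ] HilbertTensor HA HB),
    IsState ρ ∧ IsProjectiveMeasurement E ∧ IsProjectiveMeasurement F ∧
      ∀ a b x y, trace (ρ * tensorOp (E x a) (F y b)) = (P.prob a b x y : ℂ)

end Tsirelson

end

/-! Suppose that Alice's random measurements settle, and let `σ` be the trace-norm limit of
`Ω^N(ρ)`. Then `σ` is a self-adjoint Hilbert–Schmidt fixed point of `Ω`. Because `Ω` preserves the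
trace, comparing the traces of `Ω(σ²)` and `σ²` shows that all commutators `[σ, E x a]` have
Hilbert–Schmidt norm zero (`commute_of_fixed`). The projection onto `ker σ` therefore commutes with
the `E x a`; the weight of `ρ` under it is conserved by `Ω` and vanishes in the limit, so `√ρ`
annihilates `ker σ` (`exists_commuting`).

A Hilbert–Schmidt operator commuting with Alice's algebra forces a tensor splitting. Alice keeps
`H`, and Bob acts by left multiplication on the Hilbert–Schmidt operators. With `P` the projection
onto those that commute with every `E x a`, the map `m : v ⊗ t ↦ (P t)(σ v)` is bounded and carries
`E ⊗ leftMul F` to `E F`. The kernel of its adjoint lies in `ker σ`, since `m (u ⊗ σ) = σ² u`. The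
partial isometry `W` in the polar decomposition of `m†` then compresses `E ⊗ leftMul F` to `E F` as
far as `√ρ` can see (`exists_compression`, `exists_tensor_compression`), and `W ρ W†` is the
required state. If it is Bob who settles, the two factors are exchanged. -/

noncomputable section

namespace Tsirelson

open ContinuousLinearMap Filter
open scoped InnerProduct

set_option linter.unusedSectionVars false

/-! ### Hilbert–Schmidt norm and cyclicity of the trace -/

section HilbertSchmidt

variable {H K L : Type*} [NormedAddCommGroup H] [InnerProductSpace ℂ H] [CompleteSpace H]
  [NormedAddCommGroup K] [InnerProductSpace ℂ K] [CompleteSpace K]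
  [NormedAddCommGroup L] [InnerProductSpace ℂ L] [CompleteSpace L]

/-- The square of the Hilbert–Schmidt norm, with values in `[0, ∞]`. -/
def hsNormSq (T : H →L[ℂ] K) : ENNReal := ∑' i, ‖T (basis H i)‖ₑ ^ 2

lemma hasSum_norm_inner_basis_sq (v : H) :
    HasSum (fun i => ‖⟪basis H i, v⟫_ℂ‖ ^ 2) (‖v‖ ^ 2) := by
  have h := (basis H).hasSum_inner_mul_inner v v
  have h2 := (Complex.hasSum_iff _ _).1 h |>.1
  have e1 : (⟪v, v⟫_ℂ).re = ‖v‖ ^ 2 := inner_self_eq_norm_sq (𝕜 := ℂ) v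
  rw [e1] at h2
  refine h2.congr_fun ?_
  intro i
  rw [← inner_conj_symm (basis H i) v, Complex.mul_conj']
  simp [← Complex.ofReal_pow, norm_inner_symm v]

lemma tsum_enorm_inner_basis_sq (v : H) :
    ∑' i, ‖⟪basis H i, v⟫_ℂ‖ₑ ^ 2 = ‖v‖ₑ ^ 2 := by
  have h := hasSum_norm_inner_basis_sq v
  have := ENNReal.ofReal_tsum_of_nonneg (fun i => by positivity) h.summable
  rw [h.tsum_eq] at this
  simpa [ENNReal.ofReal_pow, ofReal_norm] using this.symm

/-- By Parseval both sides are the sum of the squared moduli of all matrix entries. -/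
lemma hsNormSq_adjoint (T : H →L[ℂ] K) : hsNormSq (T†) = hsNormSq T := by
  calc hsNormSq (T†) = ∑' i, ∑' j, ‖⟪basis H j, (T†) (basis K i)⟫_ℂ‖ₑ ^ 2 :=
        tsum_congr fun i => (tsum_enorm_inner_basis_sq _).symm
    _ = ∑' j, ∑' i, ‖⟪basis K i, T (basis H j)⟫_ℂ‖ₑ ^ 2 := by
        rw [ENNReal.tsum_comm]
        refine tsum_congr fun j => tsum_congr fun i => ?_
        rw [adjoint_inner_right, ← inner_conj_symm, RCLike.enorm_conj]
    _ = hsNormSq T := tsum_congr fun j => tsum_enorm_inner_basis_sq _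

lemma hsNormSq_comp_le_left (A : K →L[ℂ] L) (T : H →L[ℂ] K) :
    hsNormSq (A ∘L T) ≤ ‖A‖ₑ ^ 2 * hsNormSq T := by
  unfold hsNormSq
  rw [← ENNReal.tsum_mul_left]
  refine ENNReal.tsum_le_tsum fun i => ?_
  rw [← mul_pow]
  gcongr
  exact A.le_opENorm _

lemma hsNormSq_comp_le_right (T : K →L[ℂ] L) (A : H →L[ℂ] K) :
    hsNormSq (T ∘L A) ≤ ‖A‖ₑ ^ 2 * hsNormSq T := by
  rw [← hsNormSq_adjoint, adjoint_comp, ← hsNormSq_adjoint T]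
  refine (hsNormSq_comp_le_left _ _).trans_eq ?_
  congr 2
  rw [← ofReal_norm, ← ofReal_norm, LinearIsometryEquiv.norm_map]

lemma enorm_apply_sq_le_hsNormSq (T : H →L[ℂ] K) (v : H) :
    ‖T v‖ₑ ^ 2 ≤ hsNormSq T * ‖v‖ₑ ^ 2 := by
  rw [← tsum_enorm_inner_basis_sq, ← hsNormSq_adjoint, hsNormSq, ← ENNReal.tsum_mul_right]
  refine ENNReal.tsum_le_tsum fun i => ?_
  rw [← mul_pow, ← adjoint_inner_left]
  gcongr
  rw [← ofReal_norm, ← ofReal_norm, ← ofReal_norm,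
    ← ENNReal.ofReal_mul (norm_nonneg _)]
  exact ENNReal.ofReal_le_ofReal (norm_inner_le_norm _ _)

lemma enorm_sq_le_hsNormSq (T : H →L[ℂ] K) : ‖T‖ₑ ^ 2 ≤ hsNormSq T := by
  by_cases h : hsNormSq T = ⊤
  · simp [h]
  have key : ‖T‖ ≤ Real.sqrt (hsNormSq T).toReal := by
    refine T.opNorm_le_bound (Real.sqrt_nonneg _) fun v => ?_
    refine abs_le_of_sq_le_sq' ?_ (by positivity) |>.2
    rw [mul_pow, Real.sq_sqrt ENNReal.toReal_nonneg]
    have := ENNReal.toReal_mono (ENNReal.mul_ne_top h (by simp)) (enorm_apply_sq_le_hsNormSq T v)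
    simpa [ENNReal.toReal_mul] using this
  have := Real.sqrt_le_sqrt (pow_le_pow_left₀ (norm_nonneg _) key 2)
  rw [← ofReal_norm, ← ENNReal.ofReal_pow (norm_nonneg _), ← ENNReal.ofReal_toReal h]
  apply ENNReal.ofReal_le_ofReal
  calc _ ≤ _ := pow_le_pow_left₀ (norm_nonneg _) key 2
    _ = _ := Real.sq_sqrt ENNReal.toReal_nonneg

lemma summable_norm_sq_of_hsNormSq {T : H →L[ℂ] K} (hT : hsNormSq T ≠ ⊤) :
    Summable fun i => ‖T (basis H i)‖ ^ 2 := by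
  have := ENNReal.summable_toReal hT
  simpa using this

/-- For Hilbert–Schmidt operators, `tr (A† B) = tr (B A†)`. -/
lemma tsum_inner_basis_comm {A B : H →L[ℂ] K} (hA : hsNormSq A ≠ ⊤) (hB : hsNormSq B ≠ ⊤) :
    ∑' j, ⟪A (basis H j), B (basis H j)⟫_ℂ =
      ∑' i, ⟪(B†) (basis K i), (A†) (basis K i)⟫_ℂ := by
  let f : basisIndex H × basisIndex K → ℂ := fun p =>
    ⟪A (basis H p.1), basis K p.2⟫_ℂ * ⟪basis K p.2, B (basis H p.1)⟫_ℂ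
  have hs : ∀ {T : H →L[ℂ] K}, hsNormSq T ≠ ⊤ → Summable
      fun p : basisIndex H × basisIndex K => ‖⟪basis K p.2, T (basis H p.1)⟫_ℂ‖ ^ 2 := by
    intro T hT
    refine (summable_prod_of_nonneg fun _ => by positivity).2
      ⟨fun j => (hasSum_norm_inner_basis_sq (T (basis H j))).summable, ?_⟩
    exact (summable_norm_sq_of_hsNormSq hT).congr fun j =>
      (hasSum_norm_inner_basis_sq (T (basis H j))).tsum_eq.symm
  have hf : Summable f := by
    -- Since `|ab| ≤ |a|² + |b|²`, the double series converges absolutely, which permits exchanging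
    -- the sums.
    refine Summable.of_norm_bounded ((hs hA).add (hs hB)) fun p => ?_
    rw [norm_mul, norm_inner_symm]
    nlinarith [sq_nonneg (‖⟪basis K p.2, A (basis H p.1)⟫_ℂ‖ -
      ‖⟪basis K p.2, B (basis H p.1)⟫_ℂ‖), sq_nonneg (‖⟪basis K p.2, A (basis H p.1)⟫_ℂ‖ +
      ‖⟪basis K p.2, B (basis H p.1)⟫_ℂ‖)]
  have h1 := hf.tsum_comm' (f := fun j i => f (j, i)) (fun j => hf.prod_factor j)
    (fun i => hf.prod_symm.prod_factor i)
  have e1 : ∀ j, ∑' i, f (j, i) = ⟪A (basis H j), B (basis H j)⟫_ℂ := fun j =>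
    by
    simpa only [f] using! (basis K).tsum_inner_mul_inner (A (basis H j)) (B (basis H j))
  have e2 : ∀ i, ∑' j, f (j, i) = ⟪(B†) (basis K i), (A†) (basis K i)⟫_ℂ := fun i => by
    rw [← (basis H).tsum_inner_mul_inner]
    congr! 2 with j
    simp only [f, adjoint_inner_left, adjoint_inner_right]
    exact mul_comm _ _
  simp_rw [e1, e2] at h1
  exact h1.symm

end HilbertSchmidt

/-! ### Traces of positive operators and the trace norm -/

section TraceClass

variable {H : Type u} [NormedAddCommGroup H] [InnerProductSpace ℂ H] [CompleteSpace H]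

/-- The trace of a positive operator, with values in `[0, ∞]`. -/
def posTrace (T : H →L[ℂ] H) : ENNReal :=
  ∑' i, ENNReal.ofReal (RCLike.re ⟪basis H i, T (basis H i)⟫_ℂ)

lemma posTrace_adjoint_comp_self {K : Type*} [NormedAddCommGroup K] [InnerProductSpace ℂ K]
    [CompleteSpace K] (R : H →L[ℂ] K) : posTrace (R† ∘L R) = hsNormSq R := by
  refine tsum_congr fun i => ?_
  rw [ContinuousLinearMap.comp_apply, adjoint_inner_right, inner_self_eq_norm_sq,
    ENNReal.ofReal_pow (norm_nonneg _), ofReal_norm]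

lemma posTrace_star_mul_self (R : H →L[ℂ] H) : posTrace (star R * R) = hsNormSq R :=
  posTrace_adjoint_comp_self R

lemma star_sqrt (T : H →L[ℂ] H) : star (CFC.sqrt T) = CFC.sqrt T :=
  (IsSelfAdjoint.of_nonneg (CFC.sqrt_nonneg T)).star_eq

lemma adjoint_sqrt (T : H →L[ℂ] H) : (CFC.sqrt T)† = CFC.sqrt T := star_sqrt T

lemma posTrace_eq_hsNormSq_sqrt {T : H →L[ℂ] H} (hT : 0 ≤ T) :
    posTrace T = hsNormSq (CFC.sqrt T) := by
  rw [← posTrace_star_mul_self, star_sqrt, CFC.sqrt_mul_sqrt_self T hT]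

lemma traceNorm_eq_posTrace_abs (T : H →L[ℂ] H) : traceNorm T = posTrace (CFC.abs T) := rfl

lemma traceNorm_of_nonneg {T : H →L[ℂ] H} (hT : 0 ≤ T) : traceNorm T = posTrace T := by
  rw [traceNorm_eq_posTrace_abs, CFC.abs_of_nonneg T hT]

lemma traceNorm_eq_hsNormSq (T : H →L[ℂ] H) :
    traceNorm T = hsNormSq (CFC.sqrt (CFC.abs T)) :=
  posTrace_eq_hsNormSq_sqrt (CFC.abs_nonneg T)

lemma re_inner_nonneg {T : H →L[ℂ] H} (hT : 0 ≤ T) (v : H) : 0 ≤ RCLike.re ⟪v, T v⟫_ℂ :=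
  ((nonneg_iff_isPositive T).1 hT).re_inner_nonneg_right v

lemma posTrace_mono {S T : H →L[ℂ] H} (h : S ≤ T) : posTrace S ≤ posTrace T := by
  refine ENNReal.tsum_le_tsum fun i => ENNReal.ofReal_le_ofReal ?_
  have := re_inner_nonneg (sub_nonneg.2 h) (basis H i)
  rw [sub_apply, inner_sub_right, map_sub] at this
  linarith

lemma posTrace_add {S T : H →L[ℂ] H} (hS : 0 ≤ S) (hT : 0 ≤ T) :
    posTrace (S + T) = posTrace S + posTrace T := by
  unfold posTrace
  rw [← ENNReal.tsum_add]
  refine tsum_congr fun i => ?_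
  rw [add_apply, inner_add_right, map_add,
    ENNReal.ofReal_add (re_inner_nonneg hS _) (re_inner_nonneg hT _)]

@[simp] lemma posTrace_zero : posTrace (0 : H →L[ℂ] H) = 0 := by simp [posTrace]

lemma posTrace_sum {ι : Type*} (s : Finset ι) {T : ι → H →L[ℂ] H} (hT : ∀ i ∈ s, 0 ≤ T i) :
    posTrace (∑ i ∈ s, T i) = ∑ i ∈ s, posTrace (T i) := by
  classical
  induction s using Finset.induction_on with
  | empty => simp
  | insert a s ha ih =>
    rw [Finset.sum_insert ha, Finset.sum_insert ha,
      posTrace_add (hT a (Finset.mem_insert_self a s))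
        (Finset.sum_nonneg fun i hi => hT i (Finset.mem_insert_of_mem hi)),
      ih fun i hi => hT i (Finset.mem_insert_of_mem hi)]

lemma posTrace_inv_natCast_smul (n : ℕ) (T : H →L[ℂ] H) :
    posTrace ((n : ℂ)⁻¹ • T) = ENNReal.ofReal (n : ℝ)⁻¹ * posTrace T := by
  unfold posTrace
  rw [← ENNReal.tsum_mul_left]
  refine tsum_congr fun i => ?_
  rw [← ENNReal.ofReal_mul (by positivity), smul_apply, inner_smul_right]
  congr 1
  rw [show (n : ℂ)⁻¹ = (((n : ℝ)⁻¹ : ℝ) : ℂ) by push_cast; rfl]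
  exact RCLike.re_ofReal_mul _ _

/-- `A T A = R† R` with `R = √T A`, and `R` has the Hilbert–Schmidt norm of `R† = A √T`. -/
lemma posTrace_conj {T : H →L[ℂ] H} (hT : 0 ≤ T) {A : H →L[ℂ] H} (hA : IsSelfAdjoint A) :
    posTrace (A * T * A) = hsNormSq (A * CFC.sqrt T) := by
  have h : A * T * A = star (CFC.sqrt T * A) * (CFC.sqrt T * A) := by
    rw [star_mul, star_sqrt, hA.star_eq, mul_assoc A (CFC.sqrt T),
      ← mul_assoc (CFC.sqrt T) (CFC.sqrt T), CFC.sqrt_mul_sqrt_self T hT, mul_assoc]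
  rw [h, posTrace_star_mul_self, ← hsNormSq_adjoint]
  change hsNormSq (star _) = _
  rw [star_mul, star_sqrt, hA.star_eq]

lemma posTrace_conj_le {T : H →L[ℂ] H} (hT : 0 ≤ T) {q : H →L[ℂ] H} (hq : IsStarProjection q) :
    posTrace (q * T * q) ≤ posTrace T := by
  rw [posTrace_conj hT hq.isSelfAdjoint, posTrace_eq_hsNormSq_sqrt hT]
  refine (hsNormSq_comp_le_left _ _).trans (mul_le_of_le_one_left' ?_)
  refine pow_le_one' ?_ 2
  rw [← ofReal_norm]
  exact ENNReal.ofReal_le_one.2 (IsStarProjection.norm_le q hq)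

/-- `|T|` is the product of the bounded operator `√|T|` with the Hilbert–Schmidt operator `√|T|`. -/
lemma hsNormSq_ne_top_of_traceNorm_ne_top {T : H →L[ℂ] H} (hT : traceNorm T ≠ ⊤) :
    hsNormSq T ≠ ⊤ := by
  rw [traceNorm_eq_hsNormSq] at hT
  have h : hsNormSq T = hsNormSq (CFC.abs T) := by
    rw [← posTrace_star_mul_self, ← posTrace_star_mul_self,
      (IsSelfAdjoint.of_nonneg (CFC.abs_nonneg T)).star_eq, CFC.abs_mul_abs]
  rw [h, ← CFC.sqrt_mul_sqrt_self (CFC.abs T) (CFC.abs_nonneg T)]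
  exact ne_top_of_le_ne_top (ENNReal.mul_ne_top (by simp) hT) (hsNormSq_comp_le_left _ _)

/-- `‖T‖ = ‖√|T|‖²`, and the operator norm is at most the Hilbert–Schmidt norm. Hence trace-norm
limits are norm limits. -/
lemma enorm_le_traceNorm (T : H →L[ℂ] H) : ‖T‖ₑ ≤ traceNorm T := by
  rw [traceNorm_eq_hsNormSq]
  refine le_trans ?_ (enorm_sq_le_hsNormSq _)
  rw [← ofReal_norm, ← ofReal_norm, ← ENNReal.ofReal_pow (norm_nonneg _), pow_two,
    ← CStarRing.norm_star_mul_self, star_sqrt,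
    CFC.sqrt_mul_sqrt_self _ (CFC.abs_nonneg T), CFC.norm_abs]

lemma le_abs_of_isSelfAdjoint {T : H →L[ℂ] H} (hT : IsSelfAdjoint T) : T ≤ CFC.abs T := by
  rw [← sub_nonneg, CFC.abs_sub_self T hT]
  exact smul_nonneg (by norm_num) (CFC.negPart_nonneg T)

lemma posTrace_conj_le_traceNorm {T : H →L[ℂ] H} (hT : IsSelfAdjoint T) {q : H →L[ℂ] H}
    (hq : IsStarProjection q) : posTrace (q * T * q) ≤ traceNorm T := by
  refine le_trans (posTrace_mono ?_) (posTrace_conj_le (CFC.abs_nonneg T) hq)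
  exact hq.isSelfAdjoint.conjugate_le_conjugate (le_abs_of_isSelfAdjoint hT)

end TraceClass

/-! ### Projections onto invariant subspaces -/

section Commutation

variable {H : Type*} [NormedAddCommGroup H] [InnerProductSpace ℂ H] [CompleteSpace H]

/-- The projection onto a subspace that is invariant under a self-adjoint operator commutes
with this operator. -/
lemma commute_starProjection {U : Submodule ℂ H} [U.HasOrthogonalProjection] {A : H →L[ℂ] H}
    (hA : IsSelfAdjoint A) (h : ∀ v ∈ U, A v ∈ U) : Commute A U.starProjection := by
  ext v
  refine (U.eq_starProjection_of_mem_of_inner_eq_zero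
    (h _ (U.starProjection_apply_mem v)) fun w hw => ?_).symm
  change ⟪A v - A (U.starProjection v), w⟫_ℂ = 0
  rw [← map_sub, ← adjoint_inner_right, hA.adjoint_eq]
  exact U.starProjection_inner_eq_zero v _ (h w hw)

end Commutation

/-! ### Random measurements, their fixed points and the limit state -/

section RandomMeasurement

variable {H : Type u} [NormedAddCommGroup H] [InnerProductSpace ℂ H] [CompleteSpace H]
  {X A : Type*} [Fintype A] {M : X → A → H →L[ℂ] H}

lemma IsProjectiveMeasurement.conj_nonneg (hM : IsProjectiveMeasurement M) {T : H →L[ℂ] H}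
    (hT : 0 ≤ T) (x : X) (a : A) : 0 ≤ M x a * T * M x a :=
  (hM.projection x a).isSelfAdjoint.conjugate_nonneg hT

lemma IsProjectiveMeasurement.sum_enorm_sq (hM : IsProjectiveMeasurement M) (x : X) (v : H) :
    ∑ a, ‖M x a v‖ₑ ^ 2 = ‖v‖ₑ ^ 2 := by
  have h1 : ∀ a, ‖M x a v‖ ^ 2 = RCLike.re ⟪v, M x a v⟫_ℂ := fun a => by
    rw [← inner_self_eq_norm_sq (𝕜 := ℂ), ← adjoint_inner_right,
      (hM.projection x a).isSelfAdjoint.adjoint_eq, ← mul_apply_eq_comp,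
      (hM.projection x a).isIdempotentElem.eq]
  have h2 : ∑ a, ‖M x a v‖ ^ 2 = ‖v‖ ^ 2 := by
    simp_rw [h1]
    rw [← map_sum, ← inner_sum, ← sum_apply, hM.sum_eq_one x, one_apply_eq_self,
      inner_self_eq_norm_sq]
  simp_rw [← ofReal_norm, ← ENNReal.ofReal_pow (norm_nonneg _)]
  rw [← ENNReal.ofReal_sum_of_nonneg fun _ _ => by positivity, h2]

/-- Pythagoras: the vectors `M x a (√T e)` split `√T e` orthogonally for every basis vector `e`. -/
lemma IsProjectiveMeasurement.posTrace_measurementMap (hM : IsProjectiveMeasurement M)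
    {T : H →L[ℂ] H} (hT : 0 ≤ T) (x : X) : posTrace (measurementMap M x T) = posTrace T := by
  unfold measurementMap
  rw [posTrace_sum _ fun a _ => hM.conj_nonneg hT x a, posTrace_eq_hsNormSq_sqrt hT]
  simp_rw [posTrace_conj hT (hM.projection x _).isSelfAdjoint]
  unfold hsNormSq
  rw [← Summable.tsum_finsetSum fun _ _ => ENNReal.summable]
  exact tsum_congr fun i => hM.sum_enorm_sq x _

lemma IsProjectiveMeasurement.measurementMap_nonneg (hM : IsProjectiveMeasurement M)
    {T : H →L[ℂ] H} (hT : 0 ≤ T) (x : X) : 0 ≤ measurementMap M x T :=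
  Finset.sum_nonneg fun a _ => hM.conj_nonneg hT x a

variable [Fintype X]

lemma inv_natCast_smul_nonneg (n : ℕ) {T : H →L[ℂ] H} (hT : 0 ≤ T) : 0 ≤ (n : ℂ)⁻¹ • T := by
  rw [nonneg_iff_isPositive] at hT ⊢
  refine hT.smul_of_nonneg ?_
  rw [show (n : ℂ)⁻¹ = (((n : ℝ)⁻¹ : ℝ) : ℂ) by push_cast; rfl]
  exact RCLike.ofReal_nonneg.2 (inv_nonneg.2 (Nat.cast_nonneg n))

lemma IsProjectiveMeasurement.randomMeasurement_nonneg (hM : IsProjectiveMeasurement M)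
    {T : H →L[ℂ] H} (hT : 0 ≤ T) : 0 ≤ randomMeasurement M T :=
  inv_natCast_smul_nonneg _ (Finset.sum_nonneg fun x _ => hM.measurementMap_nonneg hT x)

lemma IsProjectiveMeasurement.posTrace_randomMeasurement [Nonempty X]
    (hM : IsProjectiveMeasurement M) {T : H →L[ℂ] H} (hT : 0 ≤ T) :
    posTrace (randomMeasurement M T) = posTrace T := by
  unfold randomMeasurement
  rw [posTrace_inv_natCast_smul, posTrace_sum _ fun x _ => hM.measurementMap_nonneg hT x]
  simp_rw [hM.posTrace_measurementMap hT]
  have h : (0 : ℝ) < Fintype.card X := by exact_mod_cast Fintype.card_pos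
  rw [Finset.sum_const, Finset.card_univ, nsmul_eq_mul, ← mul_assoc,
    ← ENNReal.ofReal_natCast (Fintype.card X), ← ENNReal.ofReal_mul (by positivity),
    inv_mul_cancel₀ h.ne', ENNReal.ofReal_one, one_mul]

lemma IsProjectiveMeasurement.iterate_nonneg (hM : IsProjectiveMeasurement M)
    {T : H →L[ℂ] H} (hT : 0 ≤ T) (N : ℕ) : 0 ≤ (randomMeasurement M)^[N] T := by
  induction N with
  | zero => exact hT
  | succ N ih =>
    rw [Function.iterate_succ_apply']
    exact hM.randomMeasurement_nonneg ih

lemma IsProjectiveMeasurement.posTrace_iterate [Nonempty X] (hM : IsProjectiveMeasurement M)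
    {T : H →L[ℂ] H} (hT : 0 ≤ T) (N : ℕ) :
    posTrace ((randomMeasurement M)^[N] T) = posTrace T := by
  induction N with
  | zero => rfl
  | succ N ih =>
    rw [Function.iterate_succ_apply', hM.posTrace_randomMeasurement (hM.iterate_nonneg hT N), ih]

lemma conj_randomMeasurement {q : H →L[ℂ] H} (hq : ∀ x a, Commute (M x a) q) (T : H →L[ℂ] H) :
    q * randomMeasurement M T * q = randomMeasurement M (q * T * q) := by
  unfold randomMeasurement measurementMap
  simp only [mul_smul_comm, smul_mul_assoc, Finset.mul_sum, Finset.sum_mul]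
  congr 1
  refine Finset.sum_congr rfl fun x _ => Finset.sum_congr rfl fun a _ => ?_
  calc q * (M x a * T * M x a) * q = (q * M x a) * T * (M x a * q) := by noncomm_ring
    _ = (M x a * q) * T * (q * M x a) := by rw [(hq x a).eq]
    _ = _ := by noncomm_ring

lemma conj_iterate_randomMeasurement {q : H →L[ℂ] H} (hq : ∀ x a, Commute (M x a) q)
    (T : H →L[ℂ] H) (N : ℕ) :
    q * (randomMeasurement M)^[N] T * q = (randomMeasurement M)^[N] (q * T * q) := by
  induction N with
  | zero => rfl
  | succ N ih =>
    rw [Function.iterate_succ_apply', Function.iterate_succ_apply', conj_randomMeasurement hq, ih]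

lemma continuous_randomMeasurement : Continuous (randomMeasurement M) := by
  unfold randomMeasurement measurementMap
  fun_prop

/-- A Hilbert–Schmidt fixed point of the random measurement commutes with the measurement
operators. -/
lemma IsProjectiveMeasurement.commute_of_fixed [Nonempty X] (hM : IsProjectiveMeasurement M)
    {σ : H →L[ℂ] H} (hσ : IsSelfAdjoint σ) (hs : hsNormSq σ ≠ ⊤)
    (hfix : randomMeasurement M σ = σ) (x : X) (a : A) : Commute σ (M x a) := by
  let D : X → A → H →L[ℂ] H := fun x a => σ * M x a - M x a * σ
  have hcard : (Fintype.card X : ℂ) ≠ 0 := Nat.cast_ne_zero.2 Fintype.card_ne_zero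
  have hDD : ∀ x a, star (D x a) * D x a = M x a * (star σ * σ) * M x a
      - M x a * σ * M x a * σ - σ * (M x a * σ * M x a) + σ * M x a * σ := fun x a => by
    have h1 := (hM.projection x a).isIdempotentElem.eq
    have h2 := (hM.projection x a).isSelfAdjoint.star_eq
    simp only [D, star_sub, star_mul, hσ.star_eq, h2]
    calc _ = M x a * (σ * σ) * M x a - M x a * σ * M x a * σ - σ * (M x a * σ * M x a)
          + σ * (M x a * M x a) * σ := by noncomm_ring
      _ = _ := by rw [h1]
  have hsum : ∀ x, ∑ a, star (D x a) * D x a = measurementMap M x (star σ * σ)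
      - measurementMap M x σ * σ - σ * measurementMap M x σ + star σ * σ := fun x => by
    simp_rw [hDD, measurementMap, Finset.sum_add_distrib, Finset.sum_sub_distrib,
      Finset.sum_mul, Finset.mul_sum]
    congr 1
    rw [← Finset.sum_mul, ← Finset.mul_sum, hM.sum_eq_one, mul_one, hσ.star_eq]
  -- Averaging `hsum` over `x` and using `Ω(σ) = σ` leaves `Ω(σ²) - 2σ² + σ²` for the mean of `D†
  -- D`.
  have hZ : star σ * σ + (Fintype.card X : ℂ)⁻¹ • ∑ x, ∑ a, star (D x a) * D x a
      = randomMeasurement M (star σ * σ) := by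
    have e : ∑ x, ∑ a, star (D x a) * D x a = ∑ x, measurementMap M x (star σ * σ)
        - (∑ x, measurementMap M x σ) * σ - σ * (∑ x, measurementMap M x σ)
        + Fintype.card X • (star σ * σ) := by
      simp_rw [hsum, Finset.sum_add_distrib, Finset.sum_sub_distrib, Finset.sum_mul,
        Finset.mul_sum, Finset.sum_const, Finset.card_univ]
    rw [e, smul_add, smul_sub, smul_sub, ← smul_mul_assoc, ← mul_smul_comm]
    change _ + (randomMeasurement M (star σ * σ) - randomMeasurement M σ * σ
      - σ * randomMeasurement M σ + _) = _
    rw [hfix, ← Nat.cast_smul_eq_nsmul ℂ,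
      inv_smul_smul₀ hcard, hσ.star_eq]
    abel
  have hD0 : ∀ x a, 0 ≤ star (D x a) * D x a := fun x a => star_mul_self_nonneg _
  have hS0 : ∀ x, 0 ≤ ∑ a, star (D x a) * D x a := fun x => Finset.sum_nonneg fun a _ => hD0 x a
  have htr := congrArg posTrace hZ
  rw [hM.posTrace_randomMeasurement (star_mul_self_nonneg σ),
    posTrace_add (star_mul_self_nonneg σ)
      (inv_natCast_smul_nonneg _ (Finset.sum_nonneg fun x _ => hS0 x)),
    posTrace_star_mul_self] at htr
  -- Cancelling `tr σ²` is legitimate only because it is finite: this is where `σ` must be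
  -- Hilbert–Schmidt.
  have h0 := (ENNReal.add_right_inj hs).1 (htr.trans (add_zero _).symm)
  rw [posTrace_inv_natCast_smul, posTrace_sum _ fun x _ => hS0 x, mul_eq_zero] at h0
  have hcard' : ENNReal.ofReal (Fintype.card X : ℝ)⁻¹ ≠ 0 := by
    have h : (0 : ℝ) < Fintype.card X := by exact_mod_cast Fintype.card_pos
    exact (ENNReal.ofReal_pos.2 (by positivity)).ne'
  have h1 := (Finset.sum_eq_zero_iff.1 (h0.resolve_left hcard')) x (Finset.mem_univ x)
  rw [posTrace_sum _ fun a _ => hD0 x a] at h1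
  have h2 := (Finset.sum_eq_zero_iff.1 h1) a (Finset.mem_univ a)
  rw [posTrace_star_mul_self] at h2
  have h3 := enorm_sq_le_hsNormSq (D x a)
  rw [h2, nonpos_iff_eq_zero, pow_eq_zero_iff two_ne_zero, enorm_eq_zero] at h3
  exact sub_eq_zero.1 h3

/-- Without Heat Vision there is a self-adjoint Hilbert–Schmidt operator that commutes with the
measurement operators and whose kernel is annihilated by the state. -/
theorem IsProjectiveMeasurement.exists_commuting (hM : IsProjectiveMeasurement M)
    {ρ : H →L[ℂ] H} (hρ : 0 ≤ ρ) (htr : IsTraceClass ρ) (hheat : ¬ HeatVision M ρ) :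
    ∃ σ : H →L[ℂ] H, IsSelfAdjoint σ ∧ hsNormSq σ ≠ ⊤ ∧ (∀ x a, Commute σ (M x a)) ∧
      ∀ v, σ v = 0 → CFC.sqrt ρ v = 0 := by
  rcases isEmpty_or_nonempty X with hX | hX
  -- Without settings `Ω` is zero and does not preserve the trace, but commutation is vacuous and
  -- `√ρ` itself serves.
  · refine ⟨CFC.sqrt ρ, star_sqrt ρ, ?_, fun x => hX.elim x, fun v hv => hv⟩
    rw [← posTrace_eq_hsNormSq_sqrt hρ, ← traceNorm_of_nonneg hρ]
    exact htr.ne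
  obtain ⟨σ, hσtr, hlim⟩ := not_not.1 hheat
  have hnorm : Tendsto (fun N => (randomMeasurement M)^[N] ρ) atTop (nhds σ) := by
    rw [tendsto_iff_edist_tendsto_0]
    refine tendsto_of_tendsto_of_tendsto_of_le_of_le tendsto_const_nhds hlim
      (fun _ => zero_le) fun N => ?_
    simpa only [edist_eq_enorm_sub] using enorm_le_traceNorm _
  have hσ : IsSelfAdjoint σ := by
    refine (isClosed_eq continuous_star continuous_id).mem_of_tendsto hnorm
      (Eventually.of_forall fun N => ?_)
    exact (IsSelfAdjoint.of_nonneg (hM.iterate_nonneg hρ N)).star_eq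
  have hfix : randomMeasurement M σ = σ := by
    refine tendsto_nhds_unique ((continuous_randomMeasurement.tendsto σ).comp hnorm) ?_
    refine ((tendsto_add_atTop_iff_nat 1).2 hnorm).congr fun N => ?_
    rw [Function.iterate_succ_apply']
    rfl
  have hs : hsNormSq σ ≠ ⊤ := hsNormSq_ne_top_of_traceNorm_ne_top hσtr.ne
  have hcomm := hM.commute_of_fixed hσ hs hfix
  refine ⟨σ, hσ, hs, hcomm, fun v hv => ?_⟩
  let q : H →L[ℂ] H := (LinearMap.ker (σ : H →ₗ[ℂ] H)).starProjection
  have hq : IsStarProjection q := isStarProjection_starProjection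
  have hσq : σ * q = 0 := by
    ext w
    exact (LinearMap.ker (σ : H →ₗ[ℂ] H)).starProjection_apply_mem w
  have hMq : ∀ x a, Commute (M x a) q := fun x a =>
    commute_starProjection (hM.projection x a).isSelfAdjoint fun w hw => by
      change σ (M x a w) = 0
      have h : σ w = 0 := hw
      rw [← mul_apply_eq_comp, (hcomm x a).eq, mul_apply_eq_comp, h, map_zero]
  -- The weight `tr(qρq)` equals `tr(q Ω^N(ρ) q)` for every `N`, and `q σ q = 0` allows subtracting
  -- `σ`.
  have hle : ∀ N, posTrace (q * ρ * q) ≤ traceNorm ((randomMeasurement M)^[N] ρ - σ) := fun N => by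
    rw [← hM.posTrace_iterate (hq.isSelfAdjoint.conjugate_nonneg hρ) N,
      ← conj_iterate_randomMeasurement hMq]
    refine le_of_eq_of_le (congrArg posTrace ?_) (posTrace_conj_le_traceNorm
      ((IsSelfAdjoint.of_nonneg (hM.iterate_nonneg hρ N)).sub hσ) hq)
    rw [mul_sub, sub_mul, mul_assoc q σ, hσq, mul_zero, sub_zero]
  have h0 : posTrace (q * ρ * q) = 0 :=
    le_antisymm (ge_of_tendsto' hlim hle) zero_le
  rw [posTrace_conj hρ hq.isSelfAdjoint] at h0
  have h1 := enorm_sq_le_hsNormSq (q * CFC.sqrt ρ)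
  rw [h0, nonpos_iff_eq_zero, pow_eq_zero_iff two_ne_zero, enorm_eq_zero] at h1
  have h2 : CFC.sqrt ρ * q = 0 := by
    rw [← star_eq_zero, star_mul, star_sqrt, hq.isSelfAdjoint.star_eq, h1]
  have h3 : q v = v := Submodule.starProjection_eq_self_iff.2 hv
  rw [← h3, ← mul_apply_eq_comp, h2, zero_apply]

end RandomMeasurement

/-! ### The Hilbert space of Hilbert–Schmidt operators and left multiplication -/

section HilbertSchmidtSpace

variable (H : Type u) [NormedAddCommGroup H] [InnerProductSpace ℂ H] [CompleteSpace H]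

/-- The Hilbert space of Hilbert–Schmidt operators on `H`, in which an operator is represented by
its values on the fixed orthonormal basis. -/
abbrev HSSpace : Type u := lp (fun _ : basisIndex H => H) 2

/-- Distinct basis vectors are `√2` apart, so balls of radius `1/2` around them are disjoint. -/
lemma countable_basisIndex [TopologicalSpace.SeparableSpace H] : Countable (basisIndex H) := by
  refine Pairwise.countable_of_isOpen_disjoint (s := fun i => Metric.ball (basis H i) (1 / 2))
    (fun i j hij => Metric.ball_disjoint_ball ?_) (fun i => Metric.isOpen_ball)
    fun i => ⟨basis H i, Metric.mem_ball_self (by norm_num)⟩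
  have h := (basis H).orthonormal
  have h1 := norm_sub_sq (𝕜 := ℂ) (basis H i) (basis H j)
  rw [h.2 hij, h.1 i, h.1 j] at h1
  rw [dist_eq_norm]
  norm_num at h1 ⊢
  nlinarith [norm_nonneg (basis H i - basis H j)]

instance [TopologicalSpace.SeparableSpace H] :
    TopologicalSpace.SeparableSpace (HSSpace H) := by
  classical
  have := countable_basisIndex H
  rw [← TopologicalSpace.isSeparable_univ_iff]
  have h : TopologicalSpace.IsSeparable
      (⋃ i, Set.range (lp.singleContinuousLinearMap ℂ (fun _ : basisIndex H => H) 2 i)) :=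
    TopologicalSpace.isSeparable_iUnion.2 fun i => TopologicalSpace.isSeparable_range
      (lp.singleContinuousLinearMap ℂ (fun _ : basisIndex H => H) 2 i).continuous
  refine (h.span (R := ℂ)).closure.mono fun t _ => ?_
  refine mem_closure_of_tendsto (lp.hasSum_single (by norm_num) t)
    (Eventually.of_forall fun s => Submodule.sum_mem _ fun i _ => Submodule.subset_span ?_)
  exact Set.mem_iUnion.2 ⟨i, t i, rfl⟩

variable {H}

/-- The operator represented by an element of `HSSpace H`. -/
def toOp : HSSpace H →L[ℂ] H →L[ℂ] H :=
  ((lp.dualPairing 2 2 (fun _ : basisIndex H => ContinuousLinearMap.lsmul ℂ ℂ) (K := 1)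
    (fun _ => ContinuousLinearMap.opNorm_lsmul_le)).comp
      ((basis H).repr.toContinuousLinearEquiv : H →L[ℂ] _)).flip

lemma toOp_eq_tsum (t : HSSpace H) (v : H) : toOp t v = ∑' i, ⟪basis H i, v⟫_ℂ • t i := by
  change ∑' i, (basis H).repr v i • t i = _
  simp_rw [HilbertBasis.repr_apply_apply]

lemma hasSum_toOp (t : HSSpace H) (v : H) :
    HasSum (fun i => ⟪basis H i, v⟫_ℂ • t i) (toOp t v) := by
  classical
  have h := (lp.hasSum_single (by norm_num) t).mapL ((toOp (H := H)).flip v)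
  refine h.congr_fun ?_
  intro i
  rw [flip_apply, toOp_eq_tsum, tsum_eq_single i]
  · simp
  · intro j hj
    simp [hj]

/-- The element of `HSSpace H` that represents a Hilbert–Schmidt operator. -/
def ofOp (S : H →L[ℂ] H) (hS : hsNormSq S ≠ ⊤) : HSSpace H :=
  ⟨fun i => S (basis H i), memℓp_gen (by simpa using summable_norm_sq_of_hsNormSq hS)⟩

lemma toOp_ofOp (S : H →L[ℂ] H) (hS : hsNormSq S ≠ ⊤) : toOp (ofOp S hS) = S := by
  ext v
  refine (hasSum_toOp _ v).unique ?_
  have h := ((basis H).hasSum_repr v).mapL S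
  simpa only [map_smul, HilbertBasis.repr_apply_apply] using! h

/-- Left multiplication of Hilbert–Schmidt operators by a bounded operator. -/
def leftMul (F : H →L[ℂ] H) : HSSpace H →L[ℂ] HSSpace H :=
  lp.mapCLM 2 (fun _ => F) (norm_nonneg F) fun _ => le_rfl

@[simp] lemma leftMul_apply (F : H →L[ℂ] H) (t : HSSpace H) (i : basisIndex H) :
    leftMul F t i = F (t i) := rfl

lemma toOp_leftMul (F : H →L[ℂ] H) (t : HSSpace H) : toOp (leftMul F t) = F * toOp t := by
  ext v
  refine (hasSum_toOp _ v).unique ?_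
  simpa only [map_smul] using! (hasSum_toOp t v).mapL F

lemma isSelfAdjoint_leftMul {F : H →L[ℂ] H} (hF : IsSelfAdjoint F) :
    IsSelfAdjoint (leftMul F) := by
  rw [isSelfAdjoint_iff_isSymmetric]
  intro s t
  change ⟪leftMul F s, t⟫_ℂ = ⟪s, leftMul F t⟫_ℂ
  rw [lp.inner_eq_tsum, lp.inner_eq_tsum]
  refine tsum_congr fun i => ?_
  rw [leftMul_apply, leftMul_apply, ← adjoint_inner_right, hF.adjoint_eq]

lemma isStarProjection_leftMul {F : H →L[ℂ] H} (hF : IsStarProjection F) :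
    IsStarProjection (leftMul F) where
  isSelfAdjoint := isSelfAdjoint_leftMul hF.isSelfAdjoint
  isIdempotentElem := by
    ext t i
    exact congrArg (fun S : H →L[ℂ] H => S (t i)) hF.isIdempotentElem.eq

lemma IsProjectiveMeasurement.map_leftMul {Y B : Type*} [Fintype B] {N : Y → B → H →L[ℂ] H}
    (hN : IsProjectiveMeasurement N) :
    IsProjectiveMeasurement fun y b => leftMul (N y b) where
  projection y b := isStarProjection_leftMul (hN.projection y b)
  sum_eq_one y := by
    ext t i
    have h := congrArg (fun S : H →L[ℂ] H => S (t i)) (hN.sum_eq_one y)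
    rw [sum_apply] at h ⊢
    rw [lp.coeFn_sum]
    exact (Finset.sum_apply i _ _).trans h

end HilbertSchmidtSpace

/-! ### Elementary tensors of operators and the exchange of factors -/

section Tensor

variable {HA HB : Type u} [NormedAddCommGroup HA] [InnerProductSpace ℂ HA] [CompleteSpace HA]
  [NormedAddCommGroup HB] [InnerProductSpace ℂ HB] [CompleteSpace HB]

lemma isSelfAdjoint_tensorOp {E : HA →L[ℂ] HA} {F : HB →L[ℂ] HB} (hE : IsSelfAdjoint E)
    (hF : IsSelfAdjoint F) : IsSelfAdjoint (tensorOp E F) := by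
  rw [isSelfAdjoint_iff_isSymmetric]
  intro x y
  change ⟪tensorOp E F x, y⟫_ℂ = ⟪x, tensorOp E F y⟫_ℂ
  induction x, y using UniformSpace.Completion.induction_on₂ with
  | hp => exact isClosed_eq (by fun_prop) (by fun_prop)
  | ih x y =>
    simp only [tensorOp, completion_apply_coe, UniformSpace.Completion.inner_coe]
    induction x using TensorProduct.induction_on with
    | zero => simp
    | add x x' hx hx' => rw [map_add, inner_add_left, inner_add_left, hx, hx']
    | tmul a b =>
      induction y using TensorProduct.induction_on with
      | zero => simp
      | add y y' hy hy' => rw [map_add, inner_add_right, inner_add_right, hy, hy']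
      | tmul c d =>
        rw [TensorProduct.mapL_tmul, TensorProduct.mapL_tmul, TensorProduct.inner_tmul,
          TensorProduct.inner_tmul, ← adjoint_inner_right, hE.adjoint_eq,
          ← adjoint_inner_right, hF.adjoint_eq]

/-- The flip of the factors of a Hilbert space tensor product. -/
def swapOp : HilbertTensor HA HB →L[ℂ] HilbertTensor HB HA :=
  ((TensorProduct.commIsometry ℂ HA HB).toContinuousLinearEquiv :
    HA ⊗[ℂ] HB →L[ℂ] HB ⊗[ℂ] HA).completion

lemma adjoint_swapOp_comp_swapOp :
    (swapOp (HA := HA) (HB := HB))† ∘L swapOp = ContinuousLinearMap.id ℂ _ := by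
  refine (norm_map_iff_adjoint_comp_self _).1 fun x => ?_
  induction x using UniformSpace.Completion.induction_on with
  | hp => exact isClosed_eq (by fun_prop) (by fun_prop)
  | ih x =>
    simp only [swapOp, completion_apply_coe, UniformSpace.Completion.norm_coe]
    exact (TensorProduct.commIsometry ℂ HA HB).norm_map x

lemma swapOp_comp_tensorOp (E : HA →L[ℂ] HA) (F : HB →L[ℂ] HB) :
    swapOp ∘L tensorOp E F = tensorOp F E ∘L swapOp := by
  ext x
  simp only [ContinuousLinearMap.comp_apply]
  induction x using UniformSpace.Completion.induction_on with
  | hp => exact isClosed_eq (by fun_prop) (by fun_prop)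
  | ih x =>
    simp only [swapOp, tensorOp, completion_apply_coe]
    congr 1
    induction x using TensorProduct.induction_on with
    | zero => simp
    | add x x' hx hx' => simp only [map_add, hx, hx']
    | tmul a b => rfl

lemma adjoint_swapOp_comp_comp {H : Type*} [NormedAddCommGroup H] [InnerProductSpace ℂ H]
    [CompleteSpace H] (W : H →L[ℂ] HilbertTensor HA HB) :
    (swapOp ∘L W)† ∘L (swapOp ∘L W) = W† ∘L W := by
  calc _ = W† ∘L (swapOp† ∘L swapOp) ∘L W := by rw [adjoint_comp]; rfl
    _ = _ := by rw [adjoint_swapOp_comp_swapOp, ContinuousLinearMap.id_comp]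

lemma adjoint_swapOp_comp_tensorOp_comp {H : Type*} [NormedAddCommGroup H]
    [InnerProductSpace ℂ H] [CompleteSpace H] (W : H →L[ℂ] HilbertTensor HA HB)
    (E : HA →L[ℂ] HA) (F : HB →L[ℂ] HB) :
    (swapOp ∘L W)† ∘L tensorOp F E ∘L (swapOp ∘L W) = W† ∘L tensorOp E F ∘L W := by
  calc _ = W† ∘L swapOp† ∘L (tensorOp F E ∘L swapOp) ∘L W := by rw [adjoint_comp]; rfl
    _ = W† ∘L (swapOp† ∘L swapOp) ∘L tensorOp E F ∘L W := by rw [← swapOp_comp_tensorOp]; rfl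
    _ = _ := by rw [adjoint_swapOp_comp_swapOp, ContinuousLinearMap.id_comp]

end Tensor

/-! ### Polar decomposition and compression -/

section Polar

variable {H K : Type*} [NormedAddCommGroup H] [InnerProductSpace ℂ H] [CompleteSpace H]
  [NormedAddCommGroup K] [InnerProductSpace ℂ K] [CompleteSpace K]

/-- The polar decomposition of `m†`, on the orthogonal complement of its kernel. -/
lemma exists_comp_eq_adjoint (m : K →L[ℂ] H) :
    ∃ W : H →L[ℂ] K, W ∘L CFC.sqrt (m ∘L m†) = m† := by
  set c := CFC.sqrt (m ∘L m†) with hc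
  have hC : 0 ≤ m ∘L m† := (nonneg_iff_isPositive _).2 (isPositive_self_comp_adjoint m)
  have hcc : c * c = m ∘L m† := CFC.sqrt_mul_sqrt_self _ hC
  have hsa : ∀ v w, ⟪c v, w⟫_ℂ = ⟪v, c w⟫_ℂ := fun v w => by
    rw [← adjoint_inner_right, hc, (IsSelfAdjoint.of_nonneg (CFC.sqrt_nonneg _)).adjoint_eq]
  have hnorm : ∀ v, ‖c v‖ = ‖(m†) v‖ := fun v => by
    refine (pow_left_inj₀ (norm_nonneg _) (norm_nonneg _) two_ne_zero).1 ?_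
    rw [← inner_self_eq_norm_sq (𝕜 := ℂ), ← inner_self_eq_norm_sq (𝕜 := ℂ), hsa,
      adjoint_inner_left, ← mul_apply_eq_comp, hcc]
    rfl
  let N : Submodule ℂ H := LinearMap.ker (c : H →ₗ[ℂ] H)
  have hN : ∀ w, c (N.starProjection w) = 0 := fun w => N.starProjection_apply_mem w
  -- Adding `ker c` to the range of `c` makes it dense, so `c v + n ↦ m† v` extends to all of `H`,
  -- with value zero on `ker c`.
  let e : H × H →ₗ[ℂ] H := (c : H →ₗ[ℂ] H).coprod (N.starProjection : H →ₗ[ℂ] H)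
  let f : H × H →ₗ[ℂ] K := (m† : H →ₗ[ℂ] K) ∘ₗ LinearMap.fst ℂ H H
  have he : ∀ v w, e (v, w) = c v + N.starProjection w := fun v w => rfl
  have hdense : DenseRange e := by
    have : (LinearMap.range e).topologicalClosure = ⊤ := by
      rw [Submodule.topologicalClosure_eq_top_iff, Submodule.eq_bot_iff]
      intro x hx
      rw [Submodule.mem_orthogonal] at hx
      have h1 : c x = 0 := by
        have := hx _ ⟨(c x, 0), rfl⟩
        rw [he, map_zero, add_zero, hsa] at this
        exact inner_self_eq_zero.1 this
      have h2 := hx _ ⟨(0, x), rfl⟩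
      rw [he, map_zero, zero_add, Submodule.starProjection_eq_self_iff.2 (show x ∈ N from h1)] at h2
      exact inner_self_eq_zero.1 h2
    exact (Submodule.dense_iff_topologicalClosure_eq_top).2 this
  have hbound : ∀ p, ‖f p‖ ≤ 1 * ‖e p‖ := fun ⟨v, w⟩ => by
    rw [he, one_mul]
    change ‖(m†) v‖ ≤ _
    rw [← hnorm]
    have h0 : ⟪c v, N.starProjection w⟫_ℂ = 0 := by rw [hsa, hN, inner_zero_right]
    refine (pow_le_pow_iff_left₀ (norm_nonneg _) (norm_nonneg _) two_ne_zero).1 ?_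
    rw [norm_add_sq (𝕜 := ℂ), h0]
    simp
  refine ⟨f.extendOfNorm e, ?_⟩
  ext v
  have := LinearMap.extendOfNorm_eq hdense ⟨1, hbound⟩ (v, 0)
  rw [he, map_zero, add_zero] at this
  exact this

/-- A bounded map `m : K → H` that intertwines `T` and `G` yields a map `W : H → K` through which
`T` compresses to `G` on the orthogonal complement of the kernel of `m†`. -/
theorem exists_compression (m : K →L[ℂ] H) :
    ∃ W : H →L[ℂ] K, ∀ h : H →L[ℂ] H, IsSelfAdjoint h → (∀ v, (m†) v = 0 → h v = 0) →
      ∀ (T : K →L[ℂ] K) (G : H →L[ℂ] H), IsSelfAdjoint T → IsSelfAdjoint G →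
        m ∘L T = G ∘L m → h * (W† ∘L T ∘L W) * h = h * G * h := by
  obtain ⟨W, hW⟩ := exists_comp_eq_adjoint m
  refine ⟨W, fun h hh hker T G hT hG hTG => ?_⟩
  set c := CFC.sqrt (m ∘L m†) with hc
  have hC : 0 ≤ m ∘L m† := (nonneg_iff_isPositive _).2 (isPositive_self_comp_adjoint m)
  have hcc : c * c = m ∘L m† := CFC.sqrt_mul_sqrt_self _ hC
  have hcsa : IsSelfAdjoint c := IsSelfAdjoint.of_nonneg (CFC.sqrt_nonneg _)
  have hW' : c ∘L W† = m := by
    have := congrArg adjoint hW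
    rwa [adjoint_comp, adjoint_adjoint, hcsa.adjoint_eq] at this
  have hTG' : T ∘L m† = m† ∘L G := by
    have := congrArg adjoint hTG
    rwa [adjoint_comp, adjoint_comp, hT.adjoint_eq, hG.adjoint_eq] at this
  have hGC : Commute (m ∘L m†) G := by
    change (m ∘L m†) ∘L G = G ∘L (m ∘L m†)
    rw [ContinuousLinearMap.comp_assoc, ← hTG', ← ContinuousLinearMap.comp_assoc, hTG,
      ContinuousLinearMap.comp_assoc]
  have hGc : Commute c G := by
    rw [hc]
    exact hGC.cfcₙ_nnreal _
  set D : H →L[ℂ] H := W† ∘L T ∘L W - G with hD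
  have hDsa : star D = D := by
    change D† = D
    rw [hD, map_sub, adjoint_comp, adjoint_comp, adjoint_adjoint, hT.adjoint_eq, hG.adjoint_eq,
      ContinuousLinearMap.comp_assoc]
  -- Since `W c = m†`, this is `m T m† = G m m† = G c² = c G c`; `G` commutes with `c` because it
  -- commutes with `c²`.
  have hcDc : c * D * c = 0 := by
    rw [hD, mul_sub, sub_mul, sub_eq_zero]
    calc c * (W† ∘L T ∘L W) * c = (c ∘L W†) ∘L T ∘L (W ∘L c) := rfl
      _ = (m ∘L T) ∘L m† := by rw [hW', hW, ContinuousLinearMap.comp_assoc]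
      _ = G * (c * c) := by rw [hTG, hcc]; rfl
      _ = c * G * c := by rw [hGc.eq, mul_assoc]
  have hker' : ∀ v, c v = 0 → h v = 0 := fun v hv => hker v (by
    rw [← hW, ContinuousLinearMap.comp_apply, hv, map_zero])
  -- As `h` vanishes on `ker c`, a left factor `c` may be replaced by `h`; taking adjoints does the
  -- same on the right.
  have h1 : h * D * c = 0 := by
    ext v
    exact hker' _ (congrArg (fun S : H →L[ℂ] H => S v) hcDc)
  have h2 : c * D * h = 0 := by
    rw [← star_eq_zero, star_mul, star_mul, hh.star_eq, hDsa, hcsa.star_eq, ← mul_assoc, h1]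
  have h3 : h * D * h = 0 := by
    ext v
    exact hker' _ (congrArg (fun S : H →L[ℂ] H => S v) h2)
  rw [hD, mul_sub, sub_mul, sub_eq_zero] at h3
  exact h3

end Polar

/-! ### The intertwiner from the tensor product to `H` -/

section Contraction

variable {H : Type u} [NormedAddCommGroup H] [InnerProductSpace ℂ H] [CompleteSpace H]

/-- The linear map `v ⊗ t ↦ t (σ v)`. -/
def contractₗ (σ : H →L[ℂ] H) : H ⊗[ℂ] HSSpace H →ₗ[ℂ] H :=
  TensorProduct.lift (LinearMap.mk₂ ℂ (fun v t => toOp t (σ v)) (by simp) (by simp) (by simp)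
    (by simp))

open Classical in
-- Formally the adjoint sends `w` to `∑ₖ σ eₖ ⊗ |w⟩⟨eₖ|`. Only the partial sums lie in the algebraic
-- tensor product, so the expansion is stated weakly.
lemma hasSum_inner_contractₗ {σ : H →L[ℂ] H} (hσ : IsSelfAdjoint σ) (w : H)
    (x : H ⊗[ℂ] HSSpace H) :
    HasSum (fun k => ⟪σ (basis H k) ⊗ₜ[ℂ] (lp.single 2 k w : HSSpace H), x⟫_ℂ)
      ⟪w, contractₗ σ x⟫_ℂ := by
  induction x using TensorProduct.induction_on with
  | zero => simp
  | add x y hx hy => simpa only [map_add, inner_add_right] using hx.add hy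
  | tmul v t =>
    have h := (hasSum_toOp t (σ v)).mapL (innerSL ℂ w)
    refine h.congr_fun ?_
    intro k
    rw [TensorProduct.inner_tmul, lp.inner_single_left, ← adjoint_inner_right, hσ.adjoint_eq,
      innerSL_apply_apply, inner_smul_right]

open Classical in
lemma norm_sum_tmul_single_sq (σ : H →L[ℂ] H) (w : H) (s : Finset (basisIndex H)) :
    ‖∑ k ∈ s, σ (basis H k) ⊗ₜ[ℂ] (lp.single 2 k w : HSSpace H)‖ ^ 2 =
      (∑ k ∈ s, ‖σ (basis H k)‖ ^ 2) * ‖w‖ ^ 2 := by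
  have h : ⟪∑ k ∈ s, σ (basis H k) ⊗ₜ[ℂ] (lp.single 2 k w : HSSpace H),
      ∑ k ∈ s, σ (basis H k) ⊗ₜ[ℂ] (lp.single 2 k w : HSSpace H)⟫_ℂ =
      ((∑ k ∈ s, ‖σ (basis H k)‖ ^ 2) * ‖w‖ ^ 2 : ℝ) := by
    rw [sum_inner]
    push_cast
    rw [Finset.sum_mul]
    refine Finset.sum_congr rfl fun k hk => ?_
    rw [inner_sum, Finset.sum_eq_single_of_mem k hk]
    · rw [TensorProduct.inner_tmul, lp.inner_single_left, lp.single_apply_self,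
        inner_self_eq_norm_sq_to_K, inner_self_eq_norm_sq_to_K]
      rfl
    · intro l _ hl
      rw [TensorProduct.inner_tmul, lp.inner_single_left, lp.single_apply_ne _ _ _ hl.symm,
        inner_zero_right, mul_zero]
  rw [← inner_self_eq_norm_sq (𝕜 := ℂ), h]
  exact RCLike.ofReal_re _

/-- Cauchy–Schwarz against the partial sums of the adjoint, whose norms are at most the
Hilbert–Schmidt norm of `σ` times `‖w‖`. -/
lemma norm_contractₗ_le {σ : H →L[ℂ] H} (hσ : IsSelfAdjoint σ) (hs : hsNormSq σ ≠ ⊤)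
    (x : H ⊗[ℂ] HSSpace H) :
    ‖contractₗ σ x‖ ≤ Real.sqrt (∑' k, ‖σ (basis H k)‖ ^ 2) * ‖x‖ := by
  classical
  set C := Real.sqrt (∑' k, ‖σ (basis H k)‖ ^ 2)
  have key : ∀ w, ‖⟪w, contractₗ σ x⟫_ℂ‖ ≤ C * ‖w‖ * ‖x‖ := fun w => by
    refine le_of_tendsto (hasSum_inner_contractₗ hσ w x).norm (Eventually.of_forall fun s => ?_)
    refine (congrArg norm (sum_inner (𝕜 := ℂ) s _ x).symm).trans_le ?_
    refine (norm_inner_le_norm _ _).trans ?_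
    gcongr
    refine (pow_le_pow_iff_left₀ (norm_nonneg _) (by positivity) two_ne_zero).1 ?_
    rw [norm_sum_tmul_single_sq, mul_pow, Real.sq_sqrt (tsum_nonneg fun _ => by positivity)]
    gcongr
    exact (summable_norm_sq_of_hsNormSq hs).sum_le_tsum s fun _ _ => by positivity
  have h := key (contractₗ σ x)
  rw [inner_self_eq_norm_sq_to_K, norm_pow, RCLike.norm_ofReal, abs_norm] at h
  rcases (norm_nonneg (contractₗ σ x)).eq_or_lt with h0 | h0
  · rw [← h0]; positivity
  · exact le_of_mul_le_mul_right (by linarith [pow_two ‖contractₗ σ x‖]) h0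

/-- The bounded map `v ⊗ t ↦ t (σ v)`. -/
def contract {σ : H →L[ℂ] H} (hσ : IsSelfAdjoint σ) (hs : hsNormSq σ ≠ ⊤) :
    H ⊗[ℂ] HSSpace H →L[ℂ] H :=
  (contractₗ σ).mkContinuous _ (norm_contractₗ_le hσ hs)

variable {X A : Type*}

/-- The Hilbert–Schmidt operators that commute with a family of operators. -/
def commutantHS (M : X → A → H →L[ℂ] H) : Submodule ℂ (HSSpace H) where
  carrier := {t | ∀ x a, Commute (toOp t) (M x a)}
  zero_mem' x a := by rw [map_zero]; exact Commute.zero_left _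
  add_mem' hs ht x a := by rw [map_add]; exact (hs x a).add_left (ht x a)
  smul_mem' c t ht x a := by rw [map_smul]; exact (ht x a).smul_left c

lemma isClosed_commutantHS (M : X → A → H →L[ℂ] H) :
    IsClosed (commutantHS M : Set (HSSpace H)) := by
  have : (commutantHS M : Set (HSSpace H)) =
      ⋂ (x : X) (a : A), {t | toOp t * M x a = M x a * toOp t} := by
    ext t
    simp only [Set.mem_iInter]
    rfl
  rw [this]
  exact isClosed_iInter fun x => isClosed_iInter fun a => isClosed_eq (by fun_prop) (by fun_prop)

instance (M : X → A → H →L[ℂ] H) : CompleteSpace (commutantHS M) :=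
  (isClosed_commutantHS M).completeSpace_coe

/-- The bounded map `v ⊗ t ↦ (P t) (σ v)`, where `P` is the projection onto the Hilbert–Schmidt
operators that commute with the family `M`. -/
def intertwiner (M : X → A → H →L[ℂ] H) {σ : H →L[ℂ] H} (hσ : IsSelfAdjoint σ)
    (hs : hsNormSq σ ≠ ⊤) : HilbertTensor H (HSSpace H) →L[ℂ] H :=
  (contract hσ hs ∘L TensorProduct.mapL (ContinuousLinearMap.id ℂ H)
    (commutantHS M).starProjection).fromCompletion

lemma intertwiner_tmul (M : X → A → H →L[ℂ] H) {σ : H →L[ℂ] H} (hσ : IsSelfAdjoint σ)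
    (hs : hsNormSq σ ≠ ⊤) (v : H) (t : HSSpace H) :
    intertwiner M hσ hs ((v ⊗ₜ[ℂ] t : H ⊗[ℂ] HSSpace H) : HilbertTensor H (HSSpace H)) =
      toOp ((commutantHS M).starProjection t) (σ v) := by
  rw [intertwiner, fromCompletion_apply_coe]
  rfl

/-- Left multiplication by `F` preserves the commutant, hence commutes with `P`; then `M x a` moves
leftwards through `σ`, `P t` and `F`. -/
lemma intertwiner_comp_tensorOp {M : X → A → H →L[ℂ] H} {σ : H →L[ℂ] H} (hσ : IsSelfAdjoint σ)
    (hs : hsNormSq σ ≠ ⊤) (hσM : ∀ x a, Commute σ (M x a)) (x : X) (a : A) {F : H →L[ℂ] H}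
    (hF : IsSelfAdjoint F) (hFM : ∀ x a, Commute (M x a) F) :
    intertwiner M hσ hs ∘L tensorOp (M x a) (leftMul F) =
      (M x a * F) ∘L intertwiner M hσ hs := by
  have hP : Commute (leftMul F) (commutantHS M).starProjection :=
    commute_starProjection (isSelfAdjoint_leftMul hF) fun t ht x a => by
      rw [toOp_leftMul]
      exact (hFM x a).symm.mul_left (ht x a)
  ext z
  simp only [ContinuousLinearMap.comp_apply]
  induction z using UniformSpace.Completion.induction_on with
  | hp => exact isClosed_eq (by fun_prop) (by fun_prop)
  | ih z =>
    rw [tensorOp, completion_apply_coe]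
    induction z using TensorProduct.induction_on with
    | zero => simp only [map_zero, UniformSpace.Completion.coe_zero]
    | add y z hy hz => simp only [map_add, UniformSpace.Completion.coe_add, hy, hz]
    | tmul v t =>
      have h1 : (commutantHS M).starProjection (leftMul F t) =
          leftMul F ((commutantHS M).starProjection t) :=
        (congrArg (fun S : HSSpace H →L[ℂ] HSSpace H => S t) hP.eq).symm
      have h2 : Commute (toOp ((commutantHS M).starProjection t)) (M x a) :=
        (commutantHS M).starProjection_apply_mem t x a
      rw [TensorProduct.mapL_tmul, intertwiner_tmul, intertwiner_tmul, h1, toOp_leftMul]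
      have h3 : (F * toOp ((commutantHS M).starProjection t)) * (σ * M x a) =
          M x a * F * (toOp ((commutantHS M).starProjection t) * σ) := by
        rw [(hσM x a).eq, mul_assoc, ← mul_assoc (toOp _), h2.eq, (hFM x a).eq]
        simp only [mul_assoc]
      exact congrArg (fun S : H →L[ℂ] H => S v) h3

/-- Test against `u ⊗ σ`, which `P` leaves unchanged: the pairing is `⟪u, σ² u⟫ = ‖σ u‖²`. -/
lemma apply_eq_zero_of_adjoint_intertwiner {M : X → A → H →L[ℂ] H} {σ : H →L[ℂ] H}
    (hσ : IsSelfAdjoint σ) (hs : hsNormSq σ ≠ ⊤) (hσM : ∀ x a, Commute σ (M x a)) {u : H}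
    (hu : ((intertwiner M hσ hs)†) u = 0) : σ u = 0 := by
  have hmem : ofOp σ hs ∈ commutantHS M := fun x a => by
    rw [toOp_ofOp]
    exact hσM x a
  have h : ⟪((intertwiner M hσ hs)†) u,
      ((u ⊗ₜ[ℂ] ofOp σ hs : H ⊗[ℂ] HSSpace H) : HilbertTensor H (HSSpace H))⟫_ℂ = 0 := by
    rw [hu, inner_zero_left]
  rw [adjoint_inner_left, intertwiner_tmul, Submodule.starProjection_eq_self_iff.2 hmem, toOp_ofOp,
    ← adjoint_inner_left, hσ.adjoint_eq] at h
  exact inner_self_eq_zero.1 h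

/-- If a Hilbert–Schmidt operator `σ` commutes with the projective measurement `M`, then, on the
orthogonal complement of the kernel of `σ`, the operators `M x a` and the operators commuting with
all of them are compressions of operators acting on different factors of a tensor product. -/
theorem IsProjectiveMeasurement.exists_tensor_compression [Fintype A] {M : X → A → H →L[ℂ] H}
    (hM : IsProjectiveMeasurement M) {σ : H →L[ℂ] H} (hσ : IsSelfAdjoint σ)
    (hs : hsNormSq σ ≠ ⊤) (hσM : ∀ x a, Commute σ (M x a)) :
    ∃ W : H →L[ℂ] HilbertTensor H (HSSpace H), ∀ h : H →L[ℂ] H, IsSelfAdjoint h →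
      (∀ v, σ v = 0 → h v = 0) → h * (W† ∘L W) * h = h * h ∧
      ∀ x a, ∀ F : H →L[ℂ] H, IsSelfAdjoint F → (∀ x a, Commute (M x a) F) →
        h * (W† ∘L tensorOp (M x a) (leftMul F) ∘L W) * h = h * (M x a * F) * h := by
  obtain ⟨W, hW⟩ := exists_compression (intertwiner M hσ hs)
  refine ⟨W, fun h hh hker => ?_⟩
  have hker' : ∀ v, ((intertwiner M hσ hs)†) v = 0 → h v = 0 := fun v hv =>
    hker v (apply_eq_zero_of_adjoint_intertwiner hσ hs hσM hv)
  refine ⟨?_, fun x a F hF hFM => ?_⟩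
  -- The trivial intertwining of identities gives the normalization of the transferred state.
  · have := hW h hh hker' 1 1 (IsSelfAdjoint.one _) (IsSelfAdjoint.one _) rfl
    rwa [mul_one] at this
  · have hMsa := (hM.projection x a).isSelfAdjoint
    exact hW h hh hker' _ _ (isSelfAdjoint_tensorOp hMsa (isSelfAdjoint_leftMul hF))
      ((hMsa.commute_iff hF).1 (hFM x a)) (intertwiner_comp_tensorOp hσ hs hσM x a hF hFM)

end Contraction

/-! ### Transport of the state to the tensor product -/

section Transfer

variable {H K : Type u} [NormedAddCommGroup H] [InnerProductSpace ℂ H] [CompleteSpace H]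
  [NormedAddCommGroup K] [InnerProductSpace ℂ K] [CompleteSpace K]

lemma trace_comp_adjoint_comp {R : H →L[ℂ] K} (hR : hsNormSq R ≠ ⊤) (G : K →L[ℂ] K) :
    trace (R ∘L R† ∘L G) = trace (R† ∘L G ∘L R) := by
  have hR' : hsNormSq (R†) ≠ ⊤ := by rwa [hsNormSq_adjoint]
  have hG : hsNormSq (R† ∘L G) ≠ ⊤ :=
    ne_top_of_le_ne_top (ENNReal.mul_ne_top (by simp) hR') (hsNormSq_comp_le_right _ _)
  calc trace (R ∘L R† ∘L G) = ∑' j, ⟪(R†) (basis K j), (R† ∘L G) (basis K j)⟫_ℂ :=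
        tsum_congr fun j => by rw [adjoint_inner_left]; rfl
    _ = _ := tsum_inner_basis_comm hR' hG
    _ = trace (R† ∘L G ∘L R) := tsum_congr fun i => by
        rw [adjoint_comp, adjoint_adjoint, ContinuousLinearMap.comp_apply, adjoint_inner_left,
          ← adjoint_inner_right]
        rfl

lemma trace_mul_eq_trace_sqrt_conj {ρ : H →L[ℂ] H} (hρ : 0 ≤ ρ)
    (hR : hsNormSq (CFC.sqrt ρ) ≠ ⊤) (G : H →L[ℂ] H) :
    trace (ρ * G) = trace (CFC.sqrt ρ * G * CFC.sqrt ρ) := by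
  have h := trace_comp_adjoint_comp hR G
  rw [adjoint_sqrt] at h
  conv_lhs => rw [← CFC.sqrt_mul_sqrt_self ρ hρ]
  exact h

lemma IsState.nonneg {ρ : H →L[ℂ] H} (hρ : IsState ρ) : 0 ≤ ρ :=
  (nonneg_iff_isPositive ρ).2 hρ.positive

lemma IsState.hsNormSq_sqrt_ne_top {ρ : H →L[ℂ] H} (hρ : IsState ρ) :
    hsNormSq (CFC.sqrt ρ) ≠ ⊤ := by
  rw [← posTrace_eq_hsNormSq_sqrt hρ.nonneg, ← traceNorm_of_nonneg hρ.nonneg]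
  exact hρ.traceClass.ne

lemma trace_conj_mul {ρ : H →L[ℂ] H} (hρ : IsState ρ) (W : H →L[ℂ] K) (T : K →L[ℂ] K) :
    trace ((W ∘L ρ ∘L W†) * T) = trace (CFC.sqrt ρ * (W† ∘L T ∘L W) * CFC.sqrt ρ) := by
  have hR : hsNormSq (W ∘L CFC.sqrt ρ) ≠ ⊤ :=
    ne_top_of_le_ne_top (ENNReal.mul_ne_top (by simp) hρ.hsNormSq_sqrt_ne_top)
      (hsNormSq_comp_le_left _ _)
  have h := trace_comp_adjoint_comp hR T
  rw [adjoint_comp, adjoint_sqrt] at h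
  conv_lhs => rw [← CFC.sqrt_mul_sqrt_self ρ hρ.nonneg]
  exact h

/-- The hypothesis says that `W` is isometric on the range of `√ρ`, so the trace is kept. -/
lemma IsState.conj {ρ : H →L[ℂ] H} (hρ : IsState ρ) {W : H →L[ℂ] K}
    (hW : CFC.sqrt ρ * (W† ∘L W) * CFC.sqrt ρ = CFC.sqrt ρ * CFC.sqrt ρ) :
    IsState (W ∘L ρ ∘L W†) where
  positive := hρ.positive.conj_adjoint W
  traceClass := by
    have h0 : 0 ≤ W ∘L ρ ∘L W† := (nonneg_iff_isPositive _).2 (hρ.positive.conj_adjoint W)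
    have h1 : W ∘L ρ ∘L W† = (CFC.sqrt ρ ∘L W†)† ∘L (CFC.sqrt ρ ∘L W†) := by
      rw [adjoint_comp, adjoint_adjoint, adjoint_sqrt]
      conv_lhs => rw [← CFC.sqrt_mul_sqrt_self ρ hρ.nonneg]
      rfl
    rw [IsTraceClass, traceNorm_of_nonneg h0, h1, posTrace_adjoint_comp_self]
    exact (hsNormSq_comp_le_right _ _).trans_lt
      (ENNReal.mul_lt_top (by simp) hρ.hsNormSq_sqrt_ne_top.lt_top)
  trace_eq_one := by
    have h := trace_conj_mul hρ W 1
    rw [mul_one] at h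
    rw [h]
    change trace (CFC.sqrt ρ * (W† ∘L W) * CFC.sqrt ρ) = 1
    rw [hW, CFC.sqrt_mul_sqrt_self ρ hρ.nonneg, hρ.trace_eq_one]

variable {X Y A B : Type*} [Fintype A] [Fintype B]

/-- A field representation whose operators are, in the state `ρ`, compressions of elementary
tensors gives rise to a tensor representation. -/
theorem IsFieldRepresentation.isNonRelativistic {P : Behavior X Y A B}
    {E : X → A → H →L[ℂ] H} {F : Y → B → H →L[ℂ] H} {ρ : H →L[ℂ] H}
    (hrep : IsFieldRepresentation P E F ρ)
    {HA HB : Type u} [NormedAddCommGroup HA] [InnerProductSpace ℂ HA] [CompleteSpace HA]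
    [NormedAddCommGroup HB] [InnerProductSpace ℂ HB] [CompleteSpace HB]
    [TopologicalSpace.SeparableSpace HA] [TopologicalSpace.SeparableSpace HB]
    {E' : X → A → HA →L[ℂ] HA} {F' : Y → B → HB →L[ℂ] HB} (hE' : IsProjectiveMeasurement E')
    (hF' : IsProjectiveMeasurement F') {W : H →L[ℂ] HilbertTensor HA HB}
    (hW : CFC.sqrt ρ * (W† ∘L W) * CFC.sqrt ρ = CFC.sqrt ρ * CFC.sqrt ρ)
    (hEF : ∀ a b x y, CFC.sqrt ρ * (W† ∘L tensorOp (E' x a) (F' y b) ∘L W) * CFC.sqrt ρ =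
      CFC.sqrt ρ * (E x a * F y b) * CFC.sqrt ρ) :
    IsNonRelativistic.{u} P := by
  refine ⟨HA, HB, inferInstance, inferInstance, inferInstance, inferInstance, inferInstance,
    inferInstance, inferInstance, inferInstance, E', F', W ∘L ρ ∘L W†,
    hrep.state.conj hW, hE', hF', fun a b x y => ?_⟩
  rw [trace_conj_mul hrep.state, hEF, ← trace_mul_eq_trace_sqrt_conj hrep.state.nonneg
    hrep.state.hsNormSq_sqrt_ne_top, hrep.prob_eq]

end Transfer

end Tsirelson

end

/-! ### Tsirelson's theorem without Heat Vision -/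

theorem mainTheorem3
    {X Y A B : Type*}
    [Fintype X] [Fintype Y] [Fintype A] [Fintype B]
    (P : Tsirelson.Behavior X Y A B)
    {H : Type u} [NormedAddCommGroup H] [InnerProductSpace ℂ H] [CompleteSpace H]
    [TopologicalSpace.SeparableSpace H]
    (E : X → A → H →L[ℂ] H) (F : Y → B → H →L[ℂ] H) (ρ : H →L[ℂ] H)
    (hrep : Tsirelson.IsFieldRepresentation P E F ρ)
    (hheat : ¬ Tsirelson.HeatVision E ρ ∨ ¬ Tsirelson.HeatVision F ρ) :
    Tsirelson.IsNonRelativistic.{u} P := by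
  have hsa : IsSelfAdjoint (CFC.sqrt ρ) := Tsirelson.star_sqrt ρ
  rcases hheat with hheat | hheat
  · obtain ⟨σ, hσ, hs, hσE, hker⟩ :=
      hrep.alice.exists_commuting hrep.state.nonneg hrep.state.traceClass hheat
    obtain ⟨W, hW⟩ := hrep.alice.exists_tensor_compression hσ hs hσE
    obtain ⟨h1, h2⟩ := hW _ hsa hker
    exact hrep.isNonRelativistic hrep.alice hrep.bob.map_leftMul h1 fun a b x y =>
      h2 x a (F y b) (hrep.bob.projection y b).isSelfAdjoint fun x' a' => hrep.commute a' b x' y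
  · obtain ⟨σ, hσ, hs, hσF, hker⟩ :=
      hrep.bob.exists_commuting hrep.state.nonneg hrep.state.traceClass hheat
    obtain ⟨W, hW⟩ := hrep.bob.exists_tensor_compression hσ hs hσF
    obtain ⟨h1, h2⟩ := hW _ hsa hker
    -- Here Bob's operators act on `H` and Alice's by left multiplication; the swap puts Alice's
    -- factor first.
    refine hrep.isNonRelativistic (W := Tsirelson.swapOp ∘L W) hrep.alice.map_leftMul hrep.bob ?_
      fun a b x y => ?_
    · rw [Tsirelson.adjoint_swapOp_comp_comp, h1]
    · rw [Tsirelson.adjoint_swapOp_comp_tensorOp_comp,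
        h2 y b (E x a) (hrep.alice.projection x a).isSelfAdjoint
          fun y' b' => (hrep.commute a b' x y').symm, (hrep.commute a b x y).eq]
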